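/- Let $H$ be a separable complex Hilbert space, $\mathcal T(H)$ the space of trace class operators on $H$, and call a positive $\xi\in\mathcal T(H)$ with $\operatorname{tr}\xi=1$ a state. An observable is a finite or countable family $\mathsf A=(\mathsf A_x)_{x\in\Omega}$ of positive bounded operators on $H$ with $\sum_x \mathsf A_x=\mathbb 1$ (in the weak operator topology). It is rank-1 if for every $x$ there are a one-dimensional orthogonal projection $P$ and a number $0<e\le 1$ with $\mathsf A_x=eP$. An instrument implementing $\mathsf A$ is a family $(\mathcal I_x)_{x\in\Omega}$ of completely positive linear maps on $\mathcal T(H)$ with $\mathcal I_x^*(\mathbb 1)=\mathsf A_x$ for every $x$, that is, $\operatorname{tr}\mathcal I_x(Y)=\operatorname{tr}(\mathsf A_xY)$ for all $Y\in\mathcal T(H)$. Let $\mathsf A$ be an observable such that $\mathsf A_x\neq 0$ for every outcome $x\in\Omega$. Then $\mathsf A$ is rank-1 if and only if for every instrument $\mathcal I$ implementing $\mathsf A$ there are states $(\xi_x)_{x\in\Omega}$ such that $$\mathcal I_x(\varrho)=\operatorname{tr}(\varrho\,\mathsf A_x)\,\xi_x\qquad\text{for all } x\in\Omega,\ \varrho\in\mathcal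 T(H).$$ Consequently, any measurement performed after a measurement of a rank-1 observable is redundant: if $\mathsf A$ is rank-1 and $\mathcal I$ is an instrument implementing $\mathsf A$, then there are states $(\xi_x)_{x\in\Omega}$, depending only on $\mathcal I$, for which $\mathcal I$ has the above form and such that for every observable $\mathsf B=(\mathsf B_y)_{y\in\Omega'}$, all outcomes $x\in\Omega$, $y\in\Omega'$ and every state $\varrho$, $$\operatorname{tr}\bigl(\mathcal I_x(\varrho)\,\mathsf B_y\bigr)=\operatorname{tr}(\varrho\,\mathsf A_x)\,\operatorname{tr}(\xi_x\mathsf B_y),$$ where the numbers $\operatorname{tr}(\xi_x\mathsf B_y)$ do not depend on $\varrho$. -/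

import Mathlib

open scoped InnerProductSpace

noncomputable section

namespace QMeas

universe u v

section Trace

variable (H : Type u) [NormedAddCommGroup H] [InnerProductSpace ℂ H] [CompleteSpace H]

/-- The index set of a fixed orthonormal (Hilbert) basis of `H`. -/
def basisSet : Set H := (exists_hilbertBasis ℂ H).choose

/-- A fixed orthonormal (Hilbert) basis of `H`. -/
def basis : HilbertBasis (basisSet H) ℂ H := (exists_hilbertBasis ℂ H).choose_spec.choose

variable {H}

/-- The trace `tr T = ∑ᵢ ⟨bᵢ, T bᵢ⟩`. It is only used for trace class operators, for which the
series converges absolutely and does not depend on the orthonormal basis. -/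
def trace (T : H →L[ℂ] H) : ℂ := ∑' i, ⟪basis H i, T (basis H i)⟫_ℂ

/-- A positive operator of finite trace (the terms of the series are nonnegative, so this does not
depend on the orthonormal basis). -/
def IsPositiveFiniteTrace (T : H →L[ℂ] H) : Prop :=
  T.IsPositive ∧ Summable fun i => ⟪basis H i, T (basis H i)⟫_ℂ

variable (H)

/-- The trace class operators on `H`: the linear span of the positive operators of finite trace.
These are exactly the bounded operators `T` with `tr |T| < ∞`. -/
def traceClass : Submodule ℂ (H →L[ℂ] H) := Submodule.span ℂ {T | IsPositiveFiniteTrace T}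

variable {H}

/-- A state (density operator): a positive trace class operator of trace one. -/
def IsState (ρ : traceClass H) : Prop :=
  (ρ : H →L[ℂ] H).IsPositive ∧ trace (ρ : H →L[ℂ] H) = 1

end Trace

section Observables

variable {H : Type u} [NormedAddCommGroup H] [InnerProductSpace ℂ H] [CompleteSpace H]

/-- An effect: a selfadjoint operator `E` with `0 ≤ E ≤ 1` in the Loewner order. -/
def IsEffect (E : H →L[ℂ] H) : Prop := IsSelfAdjoint E ∧ 0 ≤ E ∧ E ≤ 1

/-- A rank-1 effect: `E = e P` with `P` a one-dimensional (orthogonal) projection, `0 < e ≤ 1`. -/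
def IsRankOneEffect (E : H →L[ℂ] H) : Prop :=
  IsEffect E ∧ ∃ (P : H →L[ℂ] H) (e : ℝ), IsStarProjection P ∧
    Module.finrank ℂ (LinearMap.range (P : H →ₗ[ℂ] H)) = 1 ∧ 0 < e ∧ e ≤ 1 ∧ E = (e : ℂ) • P

variable (H)

/-- A discrete observable (POVM) with outcome set `Ω`: positive operators that sum to the
identity, the sum being taken in the weak operator topology. -/
structure Observable (Ω : Type v) where
  /-- The operator belonging to an outcome. -/
  effect : Ω → (H →L[ℂ] H)
  isPositive : ∀ x, (effect x).IsPositive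
  hasSum_one : HasSum (fun x => ContinuousLinearMapWOT.ofCLM (σ := RingHom.id ℂ) (effect x)) 1

variable {H}

/-- A rank-1 observable: every effect is rank-1. -/
def Observable.IsRankOne {Ω : Type v} (A : Observable H Ω) : Prop :=
  ∀ x, IsRankOneEffect (A.effect x)

end Observables

section Instruments

variable {H : Type u} [NormedAddCommGroup H] [InnerProductSpace ℂ H] [CompleteSpace H]

/-- A `k × k` matrix of operators on `H` is positive if the operator it defines on `H ⊗ ℂᵏ = Hᵏ` is
positive, that is, if its quadratic form is real and nonnegative. -/
def IsPositiveMatrix {k : ℕ} (M : Fin k → Fin k → (H →L[ℂ] H)) : Prop :=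
  ∀ v : Fin k → H, 0 ≤ (∑ i, ∑ j, ⟪v i, M i j (v j)⟫_ℂ).re ∧
    (∑ i, ∑ j, ⟪v i, M i j (v j)⟫_ℂ).im = 0

/-- Complete positivity of a linear map on trace class operators: for every `k`, applying `Φ`
entrywise (that is, `Φ ⊗ id` on `k × k` matrices) preserves positivity. -/
def IsCompletelyPositive (Φ : traceClass H →ₗ[ℂ] traceClass H) : Prop :=
  ∀ (k : ℕ) (M : Fin k → Fin k → traceClass H),
    IsPositiveMatrix (fun i j => (M i j : H →L[ℂ] H)) →
      IsPositiveMatrix (fun i j => (Φ (M i j) : H →L[ℂ] H))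

/-- `Z = Φ^*(X)`, for the adjoint map `Φ^*` defined by the trace duality
`tr (X Φ(Y)) = tr (Φ^*(X) Y)` for all trace class `Y`. -/
def IsAdjointValue (Φ : traceClass H →ₗ[ℂ] traceClass H) (X Z : H →L[ℂ] H) : Prop :=
  ∀ Y : traceClass H, trace (X * (Φ Y : H →L[ℂ] H)) = trace (Z * (Y : H →L[ℂ] H))

/-- An instrument implementing the observable `A`: completely positive linear maps `op x` on the
trace class operators with `(op x)^*(1) = A x` for every outcome `x`. -/
structure Instrument {Ω : Type v} (A : Observable H Ω) where
  /-- The operation belonging to an outcome. -/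
  op : Ω → (traceClass H →ₗ[ℂ] traceClass H)
  completelyPositive : ∀ x, IsCompletelyPositive (op x)
  implements : ∀ x, IsAdjointValue (op x) 1 (A.effect x)

/-- The instrument has the form `ρ ↦ tr (ρ A x) ξ x` for the given family `ξ`. -/
def Instrument.HasForm {Ω : Type v} {A : Observable H Ω} (I : Instrument A)
    (ξ : Ω → traceClass H) : Prop :=
  ∀ (x : Ω) (ρ : traceClass H), I.op x ρ = trace ((ρ : H →L[ℂ] H) * A.effect x) • ξ x

end Instruments

end QMeas

end

/-!
Suppose `A x = e |φ⟩⟨φ|` with `φ` a unit vector, and let `Φ` be the operation of an instrument at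
`x`. Since `tr Φ(Y) = e ⟨φ, Y φ⟩`, positivity of `Φ` forces `Φ(Y) = 0` for every positive `Y` with
`⟨φ, Y φ⟩ = 0` (`eq_zero_of_trace_eq_zero`). In particular `Φ(|η⟩⟨η|) = 0` for `η ⊥ φ`, and
positivity of `Φ(|φ + cη⟩⟨φ + cη|)` for all scalars `c` then makes the cross terms `Φ(|φ⟩⟨η|)` and
`Φ(|η⟩⟨φ|)` vanish too (`map_rankOneTC_eq_zero`). Splitting a positive `Y` into blocks with respect
to `φ` and its orthogonal complement leaves only the diagonal block at `φ`:
`Φ(Y) = ⟨φ, Y φ⟩ Φ(|φ⟩⟨φ|)` (`map_eq_smul_of_trace_eq_zero`), so `ξ = Φ(|φ⟩⟨φ|) / e` is the state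
sought. Of complete positivity only positivity is needed here.

For the converse, it is enough to look at one instrument, the Lüders instrument `Y ↦ S Y S` with
`S` a selfadjoint square root of `A x` (`Observable.luders`). If it has the product form, all the operators
`S |u⟩⟨u| S = |S u⟩⟨S u|` are multiples of one operator, so the range of `S` is a line and, `S`
being selfadjoint, `S` and `A x = S²` are multiples of a one-dimensional projection
(`exists_eq_smul_rankOne_of_conj`). That the Lüders maps act on trace class operators and satisfy
`tr (S Y S) = tr (S² Y)` rests on the factorization of a positive operator of finite trace as the
square of a Hilbert–Schmidt operator and on the cyclicity of the trace for products of
Hilbert–Schmidt operators (`trace_mul_comm`).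
-/

open scoped InnerProductSpace ComplexOrder
open InnerProductSpace (rankOne)

namespace QMeas

variable {H : Type*} [NormedAddCommGroup H] [InnerProductSpace ℂ H] [CompleteSpace H]

/-! ### Positive operators -/

omit [CompleteSpace H] in
theorem isPositive_iff_inner_nonneg {T : H →L[ℂ] H} :
    T.IsPositive ↔ ∀ v, 0 ≤ ⟪v, T v⟫_ℂ := by
  refine ⟨fun h v => h.inner_nonneg_right v, fun h => ?_⟩
  rw [ContinuousLinearMap.isPositive_iff_complex]
  intro v
  have hv := Complex.nonneg_iff.1 (h v)
  have hre : (⟪v, T v⟫_ℂ).re = (⟪T v, v⟫_ℂ).re := by rw [← inner_conj_symm, Complex.conj_re]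
  have him : (⟪v, T v⟫_ℂ).im = -(⟪T v, v⟫_ℂ).im := by rw [← inner_conj_symm, Complex.conj_im]
  refine ⟨Complex.ext (Complex.ofReal_re _) ?_, hv.1.trans_eq hre⟩
  rw [Complex.ofReal_im]
  linarith [hv.2]

omit [CompleteSpace H] in
/-- An operator on a complex Hilbert space is determined by its quadratic form. -/
theorem ext_of_inner_self {S T : H →L[ℂ] H} (h : ∀ v, ⟪v, S v⟫_ℂ = ⟪v, T v⟫_ℂ) : S = T := by
  have : (S : H →ₗ[ℂ] H) = T := by
    rw [← ext_inner_map]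
    intro v
    have := congrArg (starRingEnd ℂ) (h v)
    simpa using this
  ext v
  exact LinearMap.congr_fun this v

theorem exists_sqrt {T : H →L[ℂ] H} (hT : T.IsPositive) :
    ∃ S : H →L[ℂ] H, ContinuousLinearMap.adjoint S = S ∧ S * S = T := by
  have hT' : 0 ≤ T := (ContinuousLinearMap.nonneg_iff_isPositive T).2 hT
  refine ⟨CFC.sqrt T, ?_, CFC.sqrt_mul_sqrt_self T hT'⟩
  have h := (ContinuousLinearMap.nonneg_iff_isPositive _).1 (CFC.sqrt_nonneg T)
  exact h.isSelfAdjoint.adjoint_eq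

theorem apply_eq_zero_of_inner_eq_zero {T : H →L[ℂ] H} (hT : T.IsPositive) {v : H}
    (h : ⟪v, T v⟫_ℂ = 0) : T v = 0 := by
  obtain ⟨S, hS, rfl⟩ := exists_sqrt hT
  have : ⟪S v, S v⟫_ℂ = 0 := by
    rwa [← ContinuousLinearMap.adjoint_inner_right, hS]
  simp [inner_self_eq_zero.1 this]

/-! ### Hilbert–Schmidt operators and cyclicity of the trace -/

theorem mul_le_sq_add_sq (a b : ℝ) : a * b ≤ a ^ 2 + b ^ 2 := by
  nlinarith [sq_nonneg (a - b), sq_nonneg a, sq_nonneg b]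

/-- Hilbert–Schmidt operators, defined through the fixed orthonormal basis that `trace` uses. -/
def IsHilbertSchmidt (X : H →L[ℂ] H) : Prop := Summable fun i => ‖X (basis H i)‖ ^ 2

/-- Parseval's identity. -/
theorem hasSum_norm_inner_sq (v : H) :
    HasSum (fun i => ‖⟪basis H i, v⟫_ℂ‖ ^ 2) (‖v‖ ^ 2) := by
  have h := Complex.hasSum_re ((basis H).hasSum_inner_mul_inner v v)
  have e : (⟪v, v⟫_ℂ).re = ‖v‖ ^ 2 := inner_self_eq_norm_sq (𝕜 := ℂ) v
  rw [e] at h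
  refine h.congr_fun fun i => ?_
  rw [← inner_conj_symm v, Complex.conj_mul', ← Complex.ofReal_pow, Complex.ofReal_re]

/-- The matrix entries of a Hilbert–Schmidt operator are square summable over both indices. This
is what allows sums over the two indices to be interchanged. -/
theorem IsHilbertSchmidt.summable_matrix {X : H →L[ℂ] H} (hX : IsHilbertSchmidt X) :
    Summable fun p : basisSet H × basisSet H => ‖⟪basis H p.2, X (basis H p.1)⟫_ℂ‖ ^ 2 := by
  refine (summable_prod_of_nonneg fun _ => sq_nonneg _).2
    ⟨fun i => (hasSum_norm_inner_sq (X (basis H i))).summable, ?_⟩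
  exact hX.congr fun i => (hasSum_norm_inner_sq (X (basis H i))).tsum_eq.symm

theorem IsHilbertSchmidt.adjoint {X : H →L[ℂ] H} (hX : IsHilbertSchmidt X) :
    IsHilbertSchmidt (ContinuousLinearMap.adjoint X) := by
  have h := (summable_prod_of_nonneg fun _ => sq_nonneg _).1
    ((Equiv.prodComm _ _).summable_iff.2 hX.summable_matrix)
  refine h.2.congr fun i => ?_
  rw [← (hasSum_norm_inner_sq _).tsum_eq]
  refine tsum_congr fun j => ?_
  rw [ContinuousLinearMap.adjoint_inner_right, ← inner_conj_symm, RCLike.norm_conj]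
  rfl

theorem IsHilbertSchmidt.mul_left {X : H →L[ℂ] H} (hX : IsHilbertSchmidt X) (T : H →L[ℂ] H) :
    IsHilbertSchmidt (T * X) := by
  refine Summable.of_nonneg_of_le (fun _ => by positivity) (fun i => ?_)
    (Summable.mul_left (‖T‖ ^ 2) hX)
  rw [← mul_pow]
  gcongr
  exact T.le_opNorm _

theorem IsHilbertSchmidt.mul_right {X : H →L[ℂ] H} (hX : IsHilbertSchmidt X) (T : H →L[ℂ] H) :
    IsHilbertSchmidt (X * T) := by
  have := (hX.adjoint.mul_left (ContinuousLinearMap.adjoint T)).adjoint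
  simpa [ContinuousLinearMap.mul_def, ContinuousLinearMap.adjoint_comp] using this

theorem summable_inner_mul {X Y : H →L[ℂ] H} (hX : IsHilbertSchmidt X) (hY : IsHilbertSchmidt Y) :
    Summable fun i => ⟪basis H i, (X * Y) (basis H i)⟫_ℂ := by
  refine Summable.of_norm_bounded (hX.adjoint.add hY) fun i => ?_
  rw [mul_apply_eq_comp, ← ContinuousLinearMap.adjoint_inner_left]
  refine (norm_inner_le_norm _ _).trans ?_
  exact mul_le_sq_add_sq _ _

theorem trace_mul_comm {X Y : H →L[ℂ] H} (hX : IsHilbertSchmidt X) (hY : IsHilbertSchmidt Y) :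
    trace (X * Y) = trace (Y * X) := by
  have expand (X Y : H →L[ℂ] H) : trace (X * Y) =
      ∑' i, ∑' j, ⟪basis H i, X (basis H j)⟫_ℂ * ⟪basis H j, Y (basis H i)⟫_ℂ := by
    refine tsum_congr fun i => ?_
    rw [mul_apply_eq_comp, ← ContinuousLinearMap.adjoint_inner_left,
      ← (basis H).tsum_inner_mul_inner]
    simp_rw [ContinuousLinearMap.adjoint_inner_left]
  rw [expand, expand, Summable.tsum_comm]
  · simp_rw [mul_comm]
  · refine Summable.of_norm_bounded
      (hX.summable_matrix.add ((Equiv.prodComm _ _).summable_iff.2 hY.summable_matrix))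
      fun p => ?_
    change ‖⟪basis H p.2, X (basis H p.1)⟫_ℂ * ⟪basis H p.1, Y (basis H p.2)⟫_ℂ‖ ≤
      ‖⟪basis H p.2, X (basis H p.1)⟫_ℂ‖ ^ 2 + ‖⟪basis H p.1, Y (basis H p.2)⟫_ℂ‖ ^ 2
    rw [norm_mul]
    exact mul_le_sq_add_sq _ _

/-! ### Trace class operators -/

theorem IsPositiveFiniteTrace.exists_isHilbertSchmidt_sqrt {T : H →L[ℂ] H}
    (hT : IsPositiveFiniteTrace T) :
    ∃ Z : H →L[ℂ] H, IsHilbertSchmidt Z ∧ ContinuousLinearMap.adjoint Z = Z ∧ Z * Z = T := by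
  obtain ⟨Z, hZ, hZT⟩ := exists_sqrt hT.1
  refine ⟨Z, ?_, hZ, hZT⟩
  refine (Complex.hasSum_re hT.2.hasSum).summable.congr fun i => ?_
  rw [← hZT, mul_apply_eq_comp, ← ContinuousLinearMap.adjoint_inner_left, hZ]
  exact inner_self_eq_norm_sq (𝕜 := ℂ) _

/-- The series defining `tr (X Y)` converges for bounded `X` and trace class `Y`. -/
theorem summable_inner_mul_traceClass (X : H →L[ℂ] H) (Y : traceClass H) :
    Summable fun i => ⟪basis H i, (X * (Y : H →L[ℂ] H)) (basis H i)⟫_ℂ := by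
  obtain ⟨Y, hY⟩ := Y
  induction hY using Submodule.span_induction with
  | mem T hT =>
    obtain ⟨Z, hZ, -, rfl⟩ := hT.exists_isHilbertSchmidt_sqrt
    simpa only [mul_assoc] using summable_inner_mul (hZ.mul_left X) hZ
  | zero => simp
  | add S T _ _ hS hT => simpa [inner_add_right] using hS.add hT
  | smul c T _ hT => simpa [inner_smul_right] using hT.mul_left c

theorem summable_inner_traceClass (Y : traceClass H) :
    Summable fun i => ⟪basis H i, (Y : H →L[ℂ] H) (basis H i)⟫_ℂ := by
  simpa using summable_inner_mul_traceClass 1 Y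

/-- The trace is faithful on positive trace class operators: its terms are nonnegative, so each
`⟨bᵢ, Y bᵢ⟩` vanishes, hence so does each `Y bᵢ`. -/
theorem eq_zero_of_trace_eq_zero (Y : traceClass H) (hY : (Y : H →L[ℂ] H).IsPositive)
    (h : trace (Y : H →L[ℂ] H) = 0) : Y = 0 := by
  have hs := (summable_inner_traceClass Y).hasSum
  rw [show (∑' i, _) = (0 : ℂ) from h,
    hasSum_zero_iff_of_nonneg fun _ => hY.inner_nonneg_right _] at hs
  have hz (i) : (Y : H →L[ℂ] H) (basis H i) = 0 :=
    apply_eq_zero_of_inner_eq_zero hY (congrFun hs i)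
  apply Subtype.ext
  refine ContinuousLinearMap.ext_on (s := Set.range (basis H)) ?_ ?_
  · exact Submodule.dense_iff_topologicalClosure_eq_top.2 (basis H).dense_span
  · rintro _ ⟨i, rfl⟩
    simpa using hz i

theorem trace_smul (c : ℂ) (T : H →L[ℂ] H) : trace (c • T) = c * trace T := by
  simp [trace, tsum_mul_left]

theorem trace_rankOne_mul (u v : H) (Y : H →L[ℂ] H) :
    trace (rankOne ℂ u v * Y) = ⟪v, Y u⟫_ℂ := by
  rw [← ContinuousLinearMap.adjoint_inner_left, ← (basis H).tsum_inner_mul_inner]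
  refine tsum_congr fun i => ?_
  simp [ContinuousLinearMap.adjoint_inner_left]

theorem trace_mul_rankOne (u v : H) (Y : H →L[ℂ] H) :
    trace (Y * rankOne ℂ u v) = ⟪v, Y u⟫_ℂ := by
  rw [← (basis H).tsum_inner_mul_inner]
  exact tsum_congr fun i => by simp

theorem rankOne_self_mem_traceClass (u : H) : rankOne ℂ u u ∈ traceClass H := by
  refine Submodule.subset_span ⟨InnerProductSpace.isPositive_rankOne_self u, ?_⟩
  simpa [inner_smul_right] using (basis H).summable_inner_mul_inner u u

/-- The off-diagonal case follows from the diagonal one by polarization. -/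
theorem rankOne_mem_traceClass (u v : H) : rankOne ℂ u v ∈ traceClass H := by
  have h : rankOne ℂ u v = (1 / 2 : ℂ) •
      (rankOne ℂ (u + v) (u + v) - rankOne ℂ u u - rankOne ℂ v v + Complex.I •
      (rankOne ℂ (u + Complex.I • v) (u + Complex.I • v) - rankOne ℂ u u - rankOne ℂ v v)) := by
    ext w
    simp only [smul_apply, add_apply, sub_apply, InnerProductSpace.rankOne_apply, inner_add_left,
      inner_smul_left, Complex.conj_I]
    match_scalars <;> ring_nf <;> (simp [Complex.I_sq]; try ring)
  rw [h]
  have m := rankOne_self_mem_traceClass (H := H)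
  exact (traceClass H).smul_mem _ (add_mem (sub_mem (sub_mem (m _) (m _)) (m _))
    ((traceClass H).smul_mem _ (sub_mem (sub_mem (m _) (m _)) (m _))))

/-- The rank one operator `|u⟩⟨v| : w ↦ ⟨v, w⟩ u` as a trace class operator. -/
noncomputable def rankOneTC (u v : H) : traceClass H := ⟨rankOne ℂ u v, rankOne_mem_traceClass u v⟩

@[simp]
theorem coe_rankOneTC (u v : H) : (rankOneTC u v : H →L[ℂ] H) = rankOne ℂ u v := rfl

/-! ### Positive maps on the trace class operators -/

theorem IsCompletelyPositive.isPositive {Φ : traceClass H →ₗ[ℂ] traceClass H}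
    (hΦ : IsCompletelyPositive Φ) {Y : traceClass H} (hY : (Y : H →L[ℂ] H).IsPositive) :
    (Φ Y : H →L[ℂ] H).IsPositive := by
  have h := hΦ 1 (fun _ _ => Y) fun v => by
    have := Complex.nonneg_iff.1 (hY.inner_nonneg_right (v 0))
    simpa using ⟨this.1, this.2.symm⟩
  rw [isPositive_iff_inner_nonneg]
  intro v
  have := h fun _ => v
  exact Complex.nonneg_iff.2 (by simpa [eq_comm] using this)

theorem eq_zero_of_forall_nonneg_add_mul {a z : ℂ} (h : ∀ s : ℝ, 0 ≤ a + s * z) : z = 0 := by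
  have hr (s : ℝ) : 0 ≤ a.re + s * z.re := by simpa using (Complex.nonneg_iff.1 (h s)).1
  have hi (s : ℝ) : 0 = a.im + s * z.im := by simpa using (Complex.nonneg_iff.1 (h s)).2
  apply Complex.ext
  · by_contra hz
    have := hr (-(a.re + 1) / z.re)
    rw [div_mul_cancel₀ _ hz] at this
    linarith
  · have h0 := hi 0
    have h1 := hi 1
    simp at h0 h1 ⊢
    linarith

theorem rankOneTC_add_smul_self (u v : H) (c : ℂ) :
    rankOneTC (u + c • v) (u + c • v) = rankOneTC u u + c • rankOneTC v u +
      starRingEnd ℂ c • rankOneTC u v + (c * starRingEnd ℂ c) • rankOneTC v v := by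
  apply Subtype.ext
  ext w
  simp
  module

/-- If a positive map kills `|v⟩⟨v|`, it kills `|u⟩⟨v|` and `|v⟩⟨u|`: otherwise the quadratic form
of the image of `|u + cv⟩⟨u + cv|`, affine in the real and imaginary parts of `c`, would fail to be
nonnegative for some `c`. -/
theorem map_rankOneTC_eq_zero {Φ : traceClass H →ₗ[ℂ] traceClass H}
    (hΦ : ∀ Y : traceClass H, (Y : H →L[ℂ] H).IsPositive → (Φ Y : H →L[ℂ] H).IsPositive)
    {u v : H} (hv : Φ (rankOneTC v v) = 0) :
    Φ (rankOneTC u v) = 0 ∧ Φ (rankOneTC v u) = 0 := by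
  have key (w : H) : ⟪w, (Φ (rankOneTC u v) : H →L[ℂ] H) w⟫_ℂ = 0 ∧
      ⟪w, (Φ (rankOneTC v u) : H →L[ℂ] H) w⟫_ℂ = 0 := by
    set z₁ := ⟪w, (Φ (rankOneTC u v) : H →L[ℂ] H) w⟫_ℂ with hz₁
    set z₂ := ⟪w, (Φ (rankOneTC v u) : H →L[ℂ] H) w⟫_ℂ with hz₂
    have h (c : ℂ) : 0 ≤ ⟪w, (Φ (rankOneTC u u) : H →L[ℂ] H) w⟫_ℂ + c * z₂ +
        starRingEnd ℂ c * z₁ := by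
      have := (hΦ (rankOneTC (u + c • v) (u + c • v))
        (InnerProductSpace.isPositive_rankOne_self _)).inner_nonneg_right w
      simpa [rankOneTC_add_smul_self, hv, inner_add_right, inner_smul_right] using this
    -- Real `c` give `z₁ + z₂ = 0`, imaginary `c` give `z₂ - z₁ = 0`.
    have h₁ : z₁ + z₂ = 0 := eq_zero_of_forall_nonneg_add_mul
        (a := ⟪w, (Φ (rankOneTC u u) : H →L[ℂ] H) w⟫_ℂ) fun s => by
      have := h s
      rw [Complex.conj_ofReal] at this
      convert this using 1
      ring
    have h₂ : Complex.I * (z₂ - z₁) = 0 := eq_zero_of_forall_nonneg_add_mul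
        (a := ⟪w, (Φ (rankOneTC u u) : H →L[ℂ] H) w⟫_ℂ) fun s => by
      have := h (s * Complex.I)
      rw [map_mul, Complex.conj_ofReal, Complex.conj_I] at this
      convert this using 1
      ring
    have h₃ := (mul_eq_zero.1 h₂).resolve_left Complex.I_ne_zero
    exact ⟨by linear_combination h₁ / 2 - h₃ / 2, by linear_combination h₁ / 2 + h₃ / 2⟩
  exact ⟨Subtype.ext <| ext_of_inner_self fun w => by simpa using (key w).1,
    Subtype.ext <| ext_of_inner_self fun w => by simpa using (key w).2⟩

/-- A positive map `Φ` whose trace `tr Φ(Y)` depends only on `⟨φ, Y φ⟩` depends itself only on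
`⟨φ, Y φ⟩`. -/
theorem map_eq_smul_of_trace_eq_zero {Φ : traceClass H →ₗ[ℂ] traceClass H}
    (hΦ : ∀ Y : traceClass H, (Y : H →L[ℂ] H).IsPositive → (Φ Y : H →L[ℂ] H).IsPositive)
    {φ : H} (hφ : ‖φ‖ = 1)
    (htr : ∀ Y : traceClass H, ⟪φ, (Y : H →L[ℂ] H) φ⟫_ℂ = 0 → trace (Φ Y : H →L[ℂ] H) = 0)
    (Y : traceClass H) :
    Φ Y = ⟪φ, (Y : H →L[ℂ] H) φ⟫_ℂ • Φ (rankOneTC φ φ) := by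
  have kill (Y : traceClass H) (hY : (Y : H →L[ℂ] H).IsPositive)
      (h : ⟪φ, (Y : H →L[ℂ] H) φ⟫_ℂ = 0) : Φ Y = 0 :=
    eq_zero_of_trace_eq_zero _ (hΦ Y hY) (htr Y h)
  have hφφ : ⟪φ, φ⟫_ℂ = 1 := by simp [inner_self_eq_norm_sq_to_K, hφ]
  have pos (Y : traceClass H) (hY : (Y : H →L[ℂ] H).IsPositive) :
      Φ Y = ⟪φ, (Y : H →L[ℂ] H) φ⟫_ℂ • Φ (rankOneTC φ φ) := by
    set c := ⟪φ, (Y : H →L[ℂ] H) φ⟫_ℂ with hc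
    have hcc : starRingEnd ℂ c = c := by
      rw [hc, inner_conj_symm, hY.inner_left_eq_inner_right]
    set η := (Y : H →L[ℂ] H) φ - c • φ with hη
    have hφη : ⟪φ, η⟫_ℂ = 0 := by
      rw [hη, inner_sub_right, inner_smul_right, hφφ, ← hc, mul_one, sub_self]
    obtain ⟨h₁, h₂⟩ := map_rankOneTC_eq_zero hΦ (u := φ) (v := η)
      (kill _ (InnerProductSpace.isPositive_rankOne_self _) (by simp [hφη]))
    -- `Z = Q Y Q`, with `Q` the projection onto the orthogonal complement of `φ`.
    set Z := Y - c • rankOneTC φ φ - rankOneTC φ η - rankOneTC η φ with hZ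
    have hquad (v : H) : ⟪v, (Z : H →L[ℂ] H) v⟫_ℂ =
        ⟪v - ⟪φ, v⟫_ℂ • φ, (Y : H →L[ℂ] H) (v - ⟪φ, v⟫_ℂ • φ)⟫_ℂ := by
      have e₁ : ⟪η, v⟫_ℂ = ⟪φ, (Y : H →L[ℂ] H) v⟫_ℂ - c * ⟪φ, v⟫_ℂ := by
        rw [hη, inner_sub_left, inner_smul_left, hcc, hY.inner_left_eq_inner_right]
      have e₂ : ⟪v, η⟫_ℂ = ⟪v, (Y : H →L[ℂ] H) φ⟫_ℂ - c * ⟪v, φ⟫_ℂ := by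
        rw [hη, inner_sub_right, inner_smul_right]
      simp only [hZ, Submodule.coe_sub, Submodule.coe_smul, coe_rankOneTC, sub_apply, smul_apply,
        InnerProductSpace.rankOne_apply, inner_sub_left, inner_sub_right, inner_smul_left,
        inner_smul_right, map_sub, map_smul, inner_conj_symm, e₁, e₂, ← hc]
      ring
    have hZ₀ : Φ Z = 0 := by
      refine kill Z (isPositive_iff_inner_nonneg.2 fun v => ?_) ?_
      · rw [hquad]
        exact hY.inner_nonneg_right _
      · rw [hquad, hφφ]
        simp
    rw [hZ, map_sub, map_sub, map_sub, h₁, h₂, map_smul, sub_zero, sub_zero, sub_eq_zero] at hZ₀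
    exact hZ₀
  obtain ⟨Y, hY⟩ := Y
  induction hY using Submodule.span_induction with
  | mem T hT => exact pos ⟨T, Submodule.subset_span hT⟩ hT.1
  | zero =>
    rw [show (⟨0, _⟩ : traceClass H) = 0 from rfl]
    simp
  | add S T hS hT ihS ihT =>
    have e : (⟨S + T, add_mem hS hT⟩ : traceClass H) = ⟨S, hS⟩ + ⟨T, hT⟩ := rfl
    rw [e, map_add, ihS, ihT, ← add_smul]
    simp
  | smul c T hT ih =>
    have e : (⟨c • T, (traceClass H).smul_mem c hT⟩ : traceClass H) = c • ⟨T, hT⟩ := rfl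
    rw [e, map_smul, ih, smul_smul]
    simp

/-! ### Rank one projections -/

theorem exists_eq_rankOne_of_isStarProjection {P : H →L[ℂ] H} (hP : IsStarProjection P)
    (h : Module.finrank ℂ (LinearMap.range (P : H →ₗ[ℂ] H)) = 1) :
    ∃ φ : H, ‖φ‖ = 1 ∧ P = rankOne ℂ φ φ := by
  obtain ⟨⟨g, x, hx⟩, hg, hspan⟩ := finrank_eq_one_iff'.1 h
  have hg0 : g ≠ 0 := fun h => hg (Subtype.ext h)
  have hPP (w : H) : P (P w) = P w := congrArg (fun T : H →L[ℂ] H => T w) hP.1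
  have hPg : P g = g := by
    rw [← hx]
    exact hPP x
  have hn : (‖g‖ : ℂ) ≠ 0 := by simpa using hg0
  refine ⟨(‖g‖⁻¹ : ℂ) • g, by simp [norm_smul, hg0], ?_⟩
  ext w
  obtain ⟨c, hc⟩ := hspan ⟨P w, w, rfl⟩
  have hc : c • g = P w := congrArg Subtype.val hc
  have hgw : ⟪g, w⟫_ℂ = c * ‖g‖ ^ 2 := by
    have : ⟪P g, w⟫_ℂ = ⟪g, P w⟫_ℂ := by
      rw [← ContinuousLinearMap.adjoint_inner_right, hP.2.adjoint_eq]
    rw [hPg] at this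
    rw [this, ← hc, inner_smul_right, inner_self_eq_norm_sq_to_K]
    rfl
  rw [← hc, InnerProductSpace.rankOne_apply, inner_smul_left, hgw, smul_smul]
  congr 1
  simp
  field_simp

/-! ### The Lüders instrument -/

theorem conj_mem_traceClass {S : H →L[ℂ] H} (hS : ContinuousLinearMap.adjoint S = S)
    {Y : H →L[ℂ] H} (hY : Y ∈ traceClass H) : S * Y * S ∈ traceClass H := by
  induction hY using Submodule.span_induction with
  | mem T hT =>
    obtain ⟨Z, hZ, -, rfl⟩ := hT.exists_isHilbertSchmidt_sqrt
    refine Submodule.subset_span ⟨?_, ?_⟩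
    · have := hT.1.conj_adjoint S
      rwa [hS] at this
    · simpa only [mul_assoc] using summable_inner_mul (hZ.mul_left S) (hZ.mul_right S)
  | zero => simp
  | add T₁ T₂ _ _ h₁ h₂ => simpa [mul_add, add_mul] using add_mem h₁ h₂
  | smul c T _ hT => simpa using (traceClass H).smul_mem c hT

theorem trace_add (X Y : traceClass H) :
    trace ((X : H →L[ℂ] H) + (Y : H →L[ℂ] H)) = trace (X : H →L[ℂ] H) + trace (Y : H →L[ℂ] H) := by
  simpa [trace, inner_add_right] using
    (summable_inner_traceClass X).tsum_add (summable_inner_traceClass Y)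

/-- With `Y = Z²` for a Hilbert–Schmidt operator `Z`, two applications of the cyclicity of the trace
to products of Hilbert–Schmidt operators move the right factor `S` to the left. -/
theorem trace_conj {S : H →L[ℂ] H} (hS : ContinuousLinearMap.adjoint S = S)
    (Y : traceClass H) :
    trace (S * (Y : H →L[ℂ] H) * S) = trace (S * S * (Y : H →L[ℂ] H)) := by
  obtain ⟨Y, hY⟩ := Y
  induction hY using Submodule.span_induction with
  | mem T hT =>
    obtain ⟨Z, hZ, -, rfl⟩ := hT.exists_isHilbertSchmidt_sqrt
    calc trace (S * (Z * Z) * S) = trace ((S * Z) * (Z * S)) := by simp only [mul_assoc]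
      _ = trace ((Z * S) * (S * Z)) := trace_mul_comm (hZ.mul_left S) (hZ.mul_right S)
      _ = trace (Z * (S * S * Z)) := by simp only [mul_assoc]
      _ = trace ((S * S * Z) * Z) := trace_mul_comm hZ (hZ.mul_left _)
      _ = trace (S * S * (Z * Z)) := by simp only [mul_assoc]
  | zero => simp
  | add X Y hX hY ihX ihY =>
    have h₁ := trace_add ⟨_, conj_mem_traceClass hS hX⟩ ⟨_, conj_mem_traceClass hS hY⟩
    have h₂ := (summable_inner_mul_traceClass (S * S) ⟨X, hX⟩).tsum_add
      (summable_inner_mul_traceClass (S * S) ⟨Y, hY⟩)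
    have h₃ : trace (S * S * X + S * S * Y) = trace (S * S * X) + trace (S * S * Y) := by
      simpa [trace, inner_add_right] using h₂
    simp only [mul_add, add_mul, h₃]
    exact h₁.trans (congrArg₂ (· + ·) ihX ihY)
  | smul c T hT ih => simp only [mul_smul_comm, smul_mul_assoc, trace_smul, ih]

/-- The map `Y ↦ S Y S` on trace class operators, for selfadjoint `S`. -/
noncomputable def conjTC (S : H →L[ℂ] H) (hS : ContinuousLinearMap.adjoint S = S) :
    traceClass H →ₗ[ℂ] traceClass H :=
  LinearMap.restrict (LinearMap.mulRight ℂ S ∘ₗ LinearMap.mulLeft ℂ S)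
    fun _ hY => conj_mem_traceClass hS hY

@[simp]
theorem coe_conjTC (S : H →L[ℂ] H) (hS : ContinuousLinearMap.adjoint S = S) (Y : traceClass H) :
    (conjTC S hS Y : H →L[ℂ] H) = S * Y * S := rfl

theorem isCompletelyPositive_conjTC (S : H →L[ℂ] H) (hS : ContinuousLinearMap.adjoint S = S) :
    IsCompletelyPositive (conjTC S hS) := by
  intro k M hM v
  have e (i j : Fin k) : ⟪v i, (conjTC S hS (M i j) : H →L[ℂ] H) (v j)⟫_ℂ =
      ⟪S (v i), (M i j : H →L[ℂ] H) (S (v j))⟫_ℂ := by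
    conv_rhs => rw [← ContinuousLinearMap.adjoint_inner_right, hS]
    rfl
  simpa only [e] using hM fun i => S (v i)

/-- A chosen selfadjoint operator with square `A x`. -/
noncomputable def Observable.sqrtEffect {Ω : Type*} (A : Observable H Ω) (x : Ω) : H →L[ℂ] H :=
  (exists_sqrt (A.isPositive x)).choose

theorem Observable.adjoint_sqrtEffect {Ω : Type*} (A : Observable H Ω) (x : Ω) :
    ContinuousLinearMap.adjoint (A.sqrtEffect x) = A.sqrtEffect x :=
  (exists_sqrt (A.isPositive x)).choose_spec.1

theorem Observable.sqrtEffect_mul_self {Ω : Type*} (A : Observable H Ω) (x : Ω) :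
    A.sqrtEffect x * A.sqrtEffect x = A.effect x :=
  (exists_sqrt (A.isPositive x)).choose_spec.2

/-- The Lüders instrument `Y ↦ S Y S` of an observable, with `S` the chosen selfadjoint square root
of `A x`. -/
noncomputable def Observable.luders {Ω : Type*} (A : Observable H Ω) : Instrument A where
  op x := conjTC (A.sqrtEffect x) (A.adjoint_sqrtEffect x)
  completelyPositive _ := isCompletelyPositive_conjTC _ _
  implements x Y := by
    rw [one_mul, coe_conjTC, trace_conj (A.adjoint_sqrtEffect x), A.sqrtEffect_mul_self]

/-- `A x ≤ 1`, because `⟨v, A x v⟩` is one of the nonnegative terms of a series with sum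
`⟨v, v⟩`. -/
theorem Observable.isEffect {Ω : Type*} (A : Observable H Ω) (x : Ω) : IsEffect (A.effect x) := by
  refine ⟨(A.isPositive x).isSelfAdjoint,
    (ContinuousLinearMap.nonneg_iff_isPositive _).2 (A.isPositive x), ?_⟩
  rw [ContinuousLinearMap.le_def, isPositive_iff_inner_nonneg]
  intro v
  have h : HasSum (fun y => ⟪v, A.effect y v⟫_ℂ) ⟪v, v⟫_ℂ :=
    A.hasSum_one.map
      ({ toFun := fun T => ⟪v, T v⟫_ℂ
         map_zero' := by simp
         map_add' := fun S T => by simp } : (H →WOT[ℂ] H) →+ ℂ)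
      (ContinuousLinearMapWOT.continuous_dual_apply v (innerSL ℂ v))
  rw [sub_apply, inner_sub_right, sub_nonneg]
  exact le_hasSum h x fun y _ => (A.isPositive y).inner_nonneg_right v

/-! ### Product form and rank-1 observables -/

/-- A nonzero selfadjoint `S` for which all `|S u⟩⟨S u|` are proportional to one operator has
one-dimensional range, so it is a multiple of a one-dimensional projection. -/
theorem exists_eq_smul_rankOne_of_conj {S : H →L[ℂ] H} (hS : ContinuousLinearMap.adjoint S = S)
    (hS0 : S ≠ 0) {ξ : H →L[ℂ] H}
    (h : ∀ u, ∃ c : ℂ, rankOne ℂ (S u) (S u) = c • ξ) :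
    ∃ (φ : H) (c : ℂ), ‖φ‖ = 1 ∧ S = c • rankOne ℂ φ φ := by
  obtain ⟨u, hu⟩ : ∃ u, S u ≠ 0 := by
    by_contra! hall
    exact hS0 (ContinuousLinearMap.ext hall)
  set g := S u with hg
  have hng : (‖g‖ : ℂ) ≠ 0 := by simpa using hu
  obtain ⟨c, hc⟩ := h u
  have hc0 : c ≠ 0 := by
    rintro rfl
    rw [zero_smul, InnerProductSpace.rankOne_eq_zero, or_self] at hc
    exact hu hc
  have range (w : H) : ∃ d : ℂ, S w = d • g := by
    by_cases hw : S w = 0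
    · exact ⟨0, by simpa using hw⟩
    obtain ⟨d, hd⟩ := h w
    have hnw : (‖S w‖ : ℂ) ≠ 0 := by simpa using hw
    have e : rankOne ℂ (S w) (S w) = (d / c) • rankOne ℂ g g := by
      rw [hd, hc, smul_smul, div_mul_cancel₀ _ hc0]
    have e' := congrArg (fun T : H →L[ℂ] H => T (S w)) e
    simp only [InnerProductSpace.rankOne_apply, smul_apply, inner_self_eq_norm_sq_to_K] at e'
    refine ⟨((‖S w‖ : ℂ) ^ 2)⁻¹ * (d / c * ⟪g, S w⟫_ℂ), ?_⟩
    rw [mul_smul, mul_smul, ← e']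
    exact (inv_smul_smul₀ (pow_ne_zero 2 hnw) _).symm
  obtain ⟨l, hl⟩ := range g
  refine ⟨(‖g‖⁻¹ : ℂ) • g, starRingEnd ℂ l, by simp [norm_smul, hu], ?_⟩
  ext w
  obtain ⟨d, hd⟩ := range w
  -- Selfadjointness determines the coefficient: `⟪g, S w⟫ = ⟪S g, w⟫`.
  have hs : d * ‖g‖ ^ 2 = starRingEnd ℂ l * ⟪g, w⟫_ℂ := by
    rw [← inner_smul_left, ← hl, ← ContinuousLinearMap.adjoint_inner_right, hS, hd,
      inner_smul_right, inner_self_eq_norm_sq_to_K]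
    rfl
  rw [hd, smul_apply, InnerProductSpace.rankOne_apply, inner_smul_left, smul_smul, smul_smul]
  congr 1
  simp
  field_simp
  exact hs

theorem Observable.isRankOneEffect_of_eq_smul {Ω : Type*} (A : Observable H Ω) {x : Ω}
    (hA : A.effect x ≠ 0) {φ : H} (hφ : ‖φ‖ = 1) {c : ℂ} (h : A.effect x = c • rankOne ℂ φ φ) :
    IsRankOneEffect (A.effect x) := by
  have hφφ : ⟪φ, φ⟫_ℂ = 1 := by simp [inner_self_eq_norm_sq_to_K, hφ]
  have hc : ⟪φ, A.effect x φ⟫_ℂ = c := by simp [h, hφ]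
  have h0 : 0 ≤ c := hc ▸ (A.isPositive x).inner_nonneg_right φ
  have h1 : c ≤ 1 := by
    have := isPositive_iff_inner_nonneg.1 ((ContinuousLinearMap.le_def _ _).1 (A.isEffect x).2.2) φ
    rw [sub_apply, inner_sub_right, hc, one_apply_eq_self, hφφ] at this
    exact sub_nonneg.1 this
  have hre : (c.re : ℂ) = c := Complex.ext rfl (Complex.nonneg_iff.1 h0).2
  have hc0 : c ≠ 0 := by
    rintro rfl
    exact hA (by rw [h, zero_smul])
  refine ⟨A.isEffect x, rankOne ℂ φ φ, c.re, InnerProductSpace.isStarProjection_rankOne_self hφ,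
    ?_, ?_, (Complex.le_def.1 h1).1, by rw [hre, h]⟩
  · have hφ0 : φ ≠ 0 := by
      rintro rfl
      simp at hφ
    rw [← Module.rank_eq_one_iff_finrank_eq_one]
    exact InnerProductSpace.rank_rankOne hφ0 hφ0
  · refine lt_of_le_of_ne (Complex.nonneg_iff.1 h0).1 fun h' => hc0 ?_
    rw [← hre, ← h', Complex.ofReal_zero]

theorem Observable.IsRankOne.exists_hasForm {Ω : Type*} {A : Observable H Ω} (hA : A.IsRankOne)
    (I : Instrument A) : ∃ ξ : Ω → traceClass H, (∀ x, IsState (ξ x)) ∧ I.HasForm ξ := by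
  have (x : Ω) : ∃ ξ : traceClass H, IsState ξ ∧ ∀ ρ : traceClass H,
      I.op x ρ = trace ((ρ : H →L[ℂ] H) * A.effect x) • ξ := by
    obtain ⟨-, P, e, hP, hP1, he, -, hAx⟩ := hA x
    obtain ⟨φ, hφ, rfl⟩ := exists_eq_rankOne_of_isStarProjection hP hP1
    have he0 : (e : ℂ) ≠ 0 := by exact_mod_cast he.ne'
    have htr (Y : traceClass H) : trace (I.op x Y : H →L[ℂ] H) =
        e * ⟪φ, (Y : H →L[ℂ] H) φ⟫_ℂ := by
      have := I.implements x Y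
      rwa [one_mul, hAx, smul_mul_assoc, trace_smul, trace_rankOne_mul] at this
    have hpos (Y : traceClass H) := (I.completelyPositive x).isPositive (Y := Y)
    refine ⟨(e : ℂ)⁻¹ • I.op x (rankOneTC φ φ), ⟨?_, ?_⟩, fun ρ => ?_⟩
    · refine (hpos _ (InnerProductSpace.isPositive_rankOne_self _)).smul_of_nonneg ?_
      rw [← Complex.ofReal_inv]
      exact_mod_cast (inv_pos.2 he).le
    · rw [Submodule.coe_smul, trace_smul, htr]
      simp [inner_self_eq_norm_sq_to_K, hφ, he0]
    · rw [hAx, mul_smul_comm, trace_smul, trace_mul_rankOne, smul_smul,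
        mul_right_comm, mul_inv_cancel₀ he0, one_mul]
      exact map_eq_smul_of_trace_eq_zero hpos hφ (fun Y hY => by rw [htr, hY, mul_zero]) ρ
  choose ξ hξ hform using this
  exact ⟨ξ, hξ, hform⟩

/-- The product form of the Lüders instrument already implies that the observable is rank-1. -/
theorem Observable.isRankOne_of_luders_hasForm {Ω : Type*} {A : Observable H Ω}
    (hA : ∀ x, A.effect x ≠ 0) {ξ : Ω → traceClass H} (h : A.luders.HasForm ξ) :
    A.IsRankOne := by
  intro x
  have hS := A.adjoint_sqrtEffect x
  have hSS := A.sqrtEffect_mul_self x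
  obtain ⟨φ, c, hφ, hc⟩ := exists_eq_smul_rankOne_of_conj hS
    (fun h0 => hA x (by rw [← hSS, h0, zero_mul])) (ξ := (ξ x : H →L[ℂ] H)) fun u => by
      refine ⟨_, Eq.trans ?_ (congrArg Subtype.val (h x (rankOneTC u u)))⟩
      -- Applied to `|u⟩⟨u|`, the Lüders operation gives `|S u⟩⟨S u|`.
      change _ = A.sqrtEffect x * rankOne ℂ u u * A.sqrtEffect x
      rw [ContinuousLinearMap.mul_def, ContinuousLinearMap.mul_def,
        InnerProductSpace.comp_rankOne, InnerProductSpace.rankOne_comp, hS]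
  refine A.isRankOneEffect_of_eq_smul (hA x) hφ (c := c * c) ?_
  rw [← hSS, hc, smul_mul_smul_comm, (InnerProductSpace.isIdempotentElem_rankOne_self hφ).eq]

end QMeas

theorem corollary3p8 {H : Type*} [NormedAddCommGroup H] [InnerProductSpace ℂ H]
    [CompleteSpace H] [TopologicalSpace.SeparableSpace H] {Ω : Type*} [Countable Ω]
    (A : QMeas.Observable H Ω)
    (hA : ∀ x, A.effect x ≠ 0) :
    (A.IsRankOne ↔
      ∀ I : QMeas.Instrument A, ∃ ξ : Ω → QMeas.traceClass H,
        (∀ x, QMeas.IsState (ξ x)) ∧ I.HasForm ξ) ∧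
    (A.IsRankOne →
      ∀ I : QMeas.Instrument A, ∃ ξ : Ω → QMeas.traceClass H,
        (∀ x, QMeas.IsState (ξ x)) ∧ I.HasForm ξ ∧
        ∀ (Ω' : Type*) [Countable Ω'] (B : QMeas.Observable H Ω') (x : Ω) (y : Ω')
          (ρ : QMeas.traceClass H), QMeas.IsState ρ →
          QMeas.trace ((I.op x ρ : H →L[ℂ] H) * B.effect y) =
            QMeas.trace ((ρ : H →L[ℂ] H) * A.effect x) *
              QMeas.trace ((ξ x : H →L[ℂ] H) * B.effect y)) := by
  refine ⟨⟨fun h I => h.exists_hasForm I, fun h => ?_⟩, fun h I => ?_⟩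
  · obtain ⟨ξ, -, hξ⟩ := h A.luders
    exact QMeas.Observable.isRankOne_of_luders_hasForm hA hξ
  · obtain ⟨ξ, hξ, hform⟩ := h.exists_hasForm I
    refine ⟨ξ, hξ, hform, fun Ω' _ B x y ρ _ => ?_⟩
    rw [hform x ρ, Submodule.coe_smul, smul_mul_assoc, QMeas.trace_smul]
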